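/- Let $k>1$ be an integer and let $x,y$ be nonzero real numbers. Write $\coth t=\cosh t/\sinh t$ for real $t\neq 0$, and let $\zeta$ denote the Riemann zeta function, $\zeta(s)=\sum_{n\ge 1} n^{-s}$ for $\Re(s)>1$. Then the two series below converge absolutely, and $$x^{2k-1}y\sum_{n=1}^{\infty}\frac{\pi\coth\left(\frac{\pi n y}{x}\right)}{n^{2k-1}}+(-1)^k\,y^{2k-1}x\sum_{n=1}^{\infty}\frac{\pi\coth\left(\frac{\pi n x}{y}\right)}{n^{2k-1}} =\left(x^{2k}+(-1)^k y^{2k}\right)\zeta(2k)-2\sum_{\substack{k_1+k_2=k\\ k_1,k_2\ge 1}}(-1)^{k_2}x^{2k_1}y^{2k_2}\zeta(2k_1)\zeta(2k_2).$$ -/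

import Mathlib

/-- The real hyperbolic cotangent `coth t = cosh t / sinh t` (meaningful for `t ≠ 0`). -/
noncomputable def coth (t : ℝ) : ℝ := Real.cosh t / Real.sinh t

/-! Expanding `π coth(πa) = 1/a + Σ_m 2a/(m² + a²)` at `a = ny/x` turns each series into a multiple
of `ζ(2k)` plus a double series of `n^{-(2k-2)} / (m²x² + n²y²)`. Swapping `m` and `n` in the second
one gives both the same denominator, which cancels in the weighted sum by a finite geometric sum
(`partial_fraction_antidiagonal`); what is left factors into products of zeta values. -/

/-- The partial fraction expansion of the hyperbolic cotangent. -/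
lemma hasSum_pi_mul_coth {a : ℝ} (ha : a ≠ 0) :
    HasSum (fun m : ℕ+ => 2 * a / ((m : ℝ) ^ 2 + a ^ 2)) (Real.pi * coth (Real.pi * a) - 1 / a) := by
  have haC : (a : ℂ) ≠ 0 := by exact_mod_cast ha
  -- The cotangent expansion is used at `ia`, where `cot(πia) = -i coth(πa)`.
  have hz : (a * Complex.I : ℂ) ∈ Complex.integerComplement := by
    rintro ⟨n, hn⟩
    have := congrArg Complex.im hn
    simp at this
    exact ha this.symm
  have hcot : (Real.pi : ℂ) * Complex.cot (Real.pi * (a * Complex.I)) - 1 / (a * Complex.I)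
      = -Complex.I * ((Real.pi * coth (Real.pi * a) - 1 / a : ℝ) : ℂ) := by
    rw [← mul_assoc, Complex.cot, Complex.cos_mul_I, Complex.sin_mul_I, coth]
    push_cast
    rw [← div_div, ← div_div, Complex.div_I, Complex.div_I]
    ring
  have hterm (n : ℕ) : cotTerm (a * Complex.I) n
      = -Complex.I * ((2 * a / (((n + 1 : ℕ) : ℝ) ^ 2 + a ^ 2) : ℝ) : ℂ) := by
    have hpos : ((n : ℝ) + 1) ^ 2 + a ^ 2 ≠ 0 := by positivity
    have hC : ((n : ℂ) + 1) ^ 2 + (a : ℂ) ^ 2 ≠ 0 := by exact_mod_cast hpos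
    have hprod : (a * Complex.I + (n + 1)) * (a * Complex.I - (n + 1))
        = -(((n : ℂ) + 1) ^ 2 + (a : ℂ) ^ 2) := by
      linear_combination (a : ℂ) ^ 2 * Complex.I_sq
    rw [cotTerm_identity hz, hprod]
    push_cast
    field_simp
  have h := (summable_cotTerm hz).hasSum_iff_tendsto_nat.mpr (tendsto_logDeriv_euler_cot_sub hz)
  rw [hcot] at h
  simp_rw [hterm] at h
  have h' := (hasSum_mul_left_iff (neg_ne_zero.mpr Complex.I_ne_zero)).mp h
  rw [Complex.hasSum_ofReal] at h'
  exact (hasSum_pnat_iff_hasSum_succ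
    (f := fun n : ℕ => 2 * a / ((n : ℝ) ^ 2 + a ^ 2))).mpr h'

lemma summable_pnat_inv_pow {s : ℕ} (hs : 1 < s) : Summable fun n : ℕ+ => ((n : ℝ) ^ s)⁻¹ :=
  (Real.summable_nat_pow_inv.mpr hs).comp_injective PNat.coe_injective

lemma riemannZeta_eq_tsum_pnat {s : ℕ} (hs : 1 < s) :
    riemannZeta s = ((∑' n : ℕ+, ((n : ℝ) ^ s)⁻¹ : ℝ) : ℂ) := by
  rw [zeta_nat_eq_tsum_of_gt_one hs]
  have h := (hasSum_pnat_iff (f := fun n : ℕ => ((n : ℝ) ^ s)⁻¹)).mp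
    (summable_pnat_inv_pow hs).hasSum
  -- The extra term at `n = 0` vanishes because `0⁻¹ = 0`.
  rw [Nat.cast_zero, zero_pow (by omega), inv_zero, add_zero] at h
  rw [← h.tsum_eq]
  push_cast
  simp only [one_div]

lemma summable_inv_pow_mul_inv_quadratic (l : ℕ) {x y : ℝ} (hx : x ≠ 0) (hy : y ≠ 0) :
    Summable fun p : ℕ+ × ℕ+ =>
      ((p.1 : ℝ) ^ (2 * l + 2))⁻¹ * ((p.2 : ℝ) ^ 2 * x ^ 2 + (p.1 : ℝ) ^ 2 * y ^ 2)⁻¹ := by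
  refine Summable.of_nonneg_of_le (fun p => by positivity) (fun p => ?_)
    (((summable_pnat_inv_pow (s := 2 * l + 2) (by omega)).mul_of_nonneg
      (summable_pnat_inv_pow (s := 2) (by omega)) (fun n => by positivity)
      (fun n => by positivity)).mul_right (x ^ 2)⁻¹)
  have h2 : (0 : ℝ) < p.2 := by exact_mod_cast p.2.pos
  -- Dropping `n²y²` leaves a product of two convergent series.
  have hD : ((p.2 : ℝ) ^ 2 * x ^ 2 + (p.1 : ℝ) ^ 2 * y ^ 2)⁻¹ ≤ ((p.2 : ℝ) ^ 2 * x ^ 2)⁻¹ :=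
    inv_anti₀ (by positivity) (le_add_of_nonneg_right (by positivity))
  rw [mul_inv] at hD
  simpa only [mul_assoc] using mul_le_mul_of_nonneg_left hD
    (show (0 : ℝ) ≤ ((p.1 : ℝ) ^ (2 * l + 2))⁻¹ by positivity)

/-- Each hyperbolic cotangent series is a zeta value plus an absolutely convergent double series. -/
lemma hasSum_pi_mul_coth_div_pow (l : ℕ) {x y : ℝ} (hx : x ≠ 0) (hy : y ≠ 0) :
    HasSum (fun n : ℕ+ => Real.pi * coth (Real.pi * (n : ℝ) * y / x) / (n : ℝ) ^ (2 * l + 3))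
      (x / y * (∑' n : ℕ+, ((n : ℝ) ^ (2 * l + 4))⁻¹) + 2 * x * y * ∑' p : ℕ+ × ℕ+,
        ((p.1 : ℝ) ^ (2 * l + 2))⁻¹ * ((p.2 : ℝ) ^ 2 * x ^ 2 + (p.1 : ℝ) ^ 2 * y ^ 2)⁻¹) := by
  have hdouble := ((summable_inv_pow_mul_inv_quadratic l hx hy).hasSum.mul_left
    (2 * x * y)).prod_fiberwise (g := fun n : ℕ+ =>
      (Real.pi * coth (Real.pi * (n * y / x)) - 1 / (n * y / x)) / (n : ℝ) ^ (2 * l + 3)) (by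
    intro n
    have hn : (n : ℝ) ≠ 0 := by exact_mod_cast n.ne_zero
    have ha : (n : ℝ) * y / x ≠ 0 := by positivity
    refine ((hasSum_pi_mul_coth ha).div_const _).congr_fun ?_
    intro m
    have hm : (m : ℝ) ≠ 0 := by exact_mod_cast m.ne_zero
    have h1 : (m : ℝ) ^ 2 * x ^ 2 + (n : ℝ) ^ 2 * y ^ 2 ≠ 0 := by positivity
    have h2 : (m : ℝ) ^ 2 + (n * y / x) ^ 2 ≠ 0 := by positivity
    have h3 : (m : ℝ) ^ 2 + (n * y / x) ^ 2
      = ((m : ℝ) ^ 2 * x ^ 2 + (n : ℝ) ^ 2 * y ^ 2) / x ^ 2 := by field_simp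
    rw [h3]
    field_simp
    ring)
  refine (((summable_pnat_inv_pow (s := 2 * l + 4) (by omega)).hasSum.mul_left (x / y)).add
    hdouble).congr_fun fun n => ?_
  have hn : (n : ℝ) ≠ 0 := by exact_mod_cast n.ne_zero
  rw [show Real.pi * (n : ℝ) * y / x = Real.pi * (n * y / x) by ring]
  field_simp
  ring

/-- This is `(a - b) Σ aⁱ b^{l-i} = a^{l+1} - b^{l+1}` with `a = x²/n²` and `b = -y²/m²`, where `a -
b` is the common denominator divided by `n²m²`. -/
lemma partial_fraction_antidiagonal (l : ℕ) {x y m n : ℝ} (hx : x ≠ 0)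
    (hm : m ≠ 0) (hn : n ≠ 0) :
    x ^ (2 * l + 2) * ((n ^ (2 * l + 2))⁻¹ * (m ^ 2 * x ^ 2 + n ^ 2 * y ^ 2)⁻¹)
      + (-1) ^ l * y ^ (2 * l + 2) * ((m ^ (2 * l + 2))⁻¹ * (m ^ 2 * x ^ 2 + n ^ 2 * y ^ 2)⁻¹)
      = ∑ q ∈ Finset.HasAntidiagonal.antidiagonal l, (-1) ^ q.2 * x ^ (2 * q.1) * y ^ (2 * q.2)
          * ((n ^ (2 * q.1 + 2))⁻¹ * (m ^ (2 * q.2 + 2))⁻¹) := by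
  have hD : m ^ 2 * x ^ 2 + n ^ 2 * y ^ 2 ≠ 0 := by positivity
  have hgeom := geom_sum₂_mul (x ^ 2 / n ^ 2) (-(y ^ 2 / m ^ 2)) (l + 1)
  have hdiff : x ^ 2 / n ^ 2 - -(y ^ 2 / m ^ 2)
      = (m ^ 2 * x ^ 2 + n ^ 2 * y ^ 2) * (n ^ 2 * m ^ 2)⁻¹ := by
    field_simp
    ring
  rw [hdiff, ← mul_assoc, mul_right_comm, ← eq_div_iff hD] at hgeom
  rw [Finset.Nat.sum_antidiagonal_eq_sum_range_succ_mk]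
  calc _ = ((x ^ 2 / n ^ 2) ^ (l + 1) - (-(y ^ 2 / m ^ 2)) ^ (l + 1))
        / (m ^ 2 * x ^ 2 + n ^ 2 * y ^ 2) := by
        rw [neg_pow (y ^ 2 / m ^ 2), div_pow, div_pow, ← pow_mul, ← pow_mul, ← pow_mul, ← pow_mul]
        ring
    _ = _ := by
        rw [← hgeom, Finset.sum_mul]
        refine Finset.sum_congr rfl fun i _ => ?_
        rw [Nat.add_sub_cancel, neg_pow (y ^ 2 / m ^ 2), div_pow, div_pow,
          ← pow_mul, ← pow_mul, ← pow_mul, ← pow_mul, pow_add, pow_add]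
        ring

/-- The reciprocity between the two double series. -/
lemma double_series_reciprocity (l : ℕ) {x y : ℝ} (hx : x ≠ 0) (hy : y ≠ 0) :
    x ^ (2 * l + 2) * (∑' p : ℕ+ × ℕ+,
        ((p.1 : ℝ) ^ (2 * l + 2))⁻¹ * ((p.2 : ℝ) ^ 2 * x ^ 2 + (p.1 : ℝ) ^ 2 * y ^ 2)⁻¹)
      + (-1) ^ l * y ^ (2 * l + 2) * (∑' p : ℕ+ × ℕ+,
        ((p.1 : ℝ) ^ (2 * l + 2))⁻¹ * ((p.2 : ℝ) ^ 2 * y ^ 2 + (p.1 : ℝ) ^ 2 * x ^ 2)⁻¹)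
      = ∑ q ∈ Finset.HasAntidiagonal.antidiagonal l, (-1) ^ q.2 * x ^ (2 * q.1) * y ^ (2 * q.2)
          * ((∑' n : ℕ+, ((n : ℝ) ^ (2 * q.1 + 2))⁻¹)
            * ∑' n : ℕ+, ((n : ℝ) ^ (2 * q.2 + 2))⁻¹) := by
  have h1 := (summable_inv_pow_mul_inv_quadratic l hx hy).hasSum.mul_left (x ^ (2 * l + 2))
  -- Absolute convergence allows the swap of `m` and `n`.
  have h2 := ((Equiv.prodComm ℕ+ ℕ+).hasSum_iff.mpr
    (summable_inv_pow_mul_inv_quadratic l hy hx).hasSum).mul_left ((-1) ^ l * y ^ (2 * l + 2))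
  refine (h1.add h2).unique ?_
  have h3 : HasSum (fun p : ℕ+ × ℕ+ => ∑ q ∈ Finset.HasAntidiagonal.antidiagonal l,
      (-1) ^ q.2 * x ^ (2 * q.1) * y ^ (2 * q.2)
        * (((p.1 : ℝ) ^ (2 * q.1 + 2))⁻¹ * ((p.2 : ℝ) ^ (2 * q.2 + 2))⁻¹))
      (∑ q ∈ Finset.HasAntidiagonal.antidiagonal l, (-1) ^ q.2 * x ^ (2 * q.1) * y ^ (2 * q.2)
        * ((∑' n : ℕ+, ((n : ℝ) ^ (2 * q.1 + 2))⁻¹)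
          * ∑' n : ℕ+, ((n : ℝ) ^ (2 * q.2 + 2))⁻¹)) := by
    refine hasSum_sum fun q _ => HasSum.mul_left _ ?_
    have hi := summable_pnat_inv_pow (s := 2 * q.1 + 2) (by omega)
    have hj := summable_pnat_inv_pow (s := 2 * q.2 + 2) (by omega)
    exact hi.hasSum.mul hj.hasSum
      (hi.mul_of_nonneg hj (fun n => by positivity) (fun n => by positivity))
  refine h3.congr_fun fun p => ?_
  rw [← partial_fraction_antidiagonal l hx (by exact_mod_cast p.2.ne_zero)
    (by exact_mod_cast p.1.ne_zero)]
  simp only [Function.comp_apply, Equiv.prodComm_apply, Prod.fst_swap, Prod.snd_swap]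
  rw [add_comm ((p.1 : ℝ) ^ 2 * y ^ 2)]

lemma sum_filter_antidiagonal_add_two {M : Type*} [AddCommMonoid M] (l : ℕ) (f : ℕ × ℕ → M) :
    ∑ p ∈ (Finset.HasAntidiagonal.antidiagonal (l + 2)).filter (fun p => 1 ≤ p.1 ∧ 1 ≤ p.2), f p
      = ∑ q ∈ Finset.HasAntidiagonal.antidiagonal l, f (q.1 + 1, q.2 + 1) := by
  rw [Finset.sum_filter, Finset.Nat.antidiagonal_succ_succ', Finset.sum_cons, Finset.sum_cons,
    Finset.sum_map]
  simp [Prod.map]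

theorem theorem2p1 (k : ℕ) (hk : 1 < k) (x y : ℝ) (hx : x ≠ 0) (hy : y ≠ 0) :
    Summable (fun n : ℕ+ => Real.pi * coth (Real.pi * (n : ℝ) * y / x) / (n : ℝ) ^ (2 * k - 1)) ∧
    Summable (fun n : ℕ+ => Real.pi * coth (Real.pi * (n : ℝ) * x / y) / (n : ℝ) ^ (2 * k - 1)) ∧
    (((∑' n : ℕ+, Real.pi * coth (Real.pi * (n : ℝ) * y / x) / (n : ℝ) ^ (2 * k - 1))
          * x ^ (2 * k - 1) * y
        + (-1) ^ k * (∑' n : ℕ+, Real.pi * coth (Real.pi * (n : ℝ) * x / y) / (n : ℝ) ^ (2 * k - 1))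
          * y ^ (2 * k - 1) * x : ℝ) : ℂ)
      = ((x : ℂ) ^ (2 * k) + (-1) ^ k * (y : ℂ) ^ (2 * k)) * riemannZeta (2 * (k : ℂ))
        - 2 * ∑ p ∈ (Finset.HasAntidiagonal.antidiagonal k).filter (fun p => 1 ≤ p.1 ∧ 1 ≤ p.2),
            (-1) ^ p.2 * (x : ℂ) ^ (2 * p.1) * (y : ℂ) ^ (2 * p.2)
              * riemannZeta (2 * (p.1 : ℂ)) * riemannZeta (2 * (p.2 : ℂ)) := by
  obtain ⟨l, rfl⟩ : ∃ l, k = l + 2 := ⟨k - 2, by omega⟩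
  rw [show 2 * (l + 2) - 1 = 2 * l + 3 by omega]
  have h1 := hasSum_pi_mul_coth_div_pow l hx hy
  have h2 := hasSum_pi_mul_coth_div_pow l hy hx
  refine ⟨h1.summable, h2.summable, ?_⟩
  have hzeta (i : ℕ) : riemannZeta (2 * ((i + 1 : ℕ) : ℂ))
      = ((∑' n : ℕ+, ((n : ℝ) ^ (2 * i + 2))⁻¹ : ℝ) : ℂ) := by
    rw [← riemannZeta_eq_tsum_pnat (by omega)]
    congr 1
    push_cast
    ring
  rw [h1.tsum_eq, h2.tsum_eq, sum_filter_antidiagonal_add_two]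
  have hrec := double_series_reciprocity l hx hy
  have hz := hzeta (l + 1)
  rw [show 2 * (l + 1) + 2 = 2 * l + 4 by ring] at hz
  simp only [hz, hzeta]
  norm_cast
  -- Shifting both indices by one releases the factor `-x²y²`, matching the sum in the reciprocity.
  have hsum : ∑ q ∈ Finset.HasAntidiagonal.antidiagonal l, (-1) ^ (q.2 + 1) * x ^ (2 * (q.1 + 1))
        * y ^ (2 * (q.2 + 1)) * (∑' n : ℕ+, ((n : ℝ) ^ (2 * q.1 + 2))⁻¹)
        * (∑' n : ℕ+, ((n : ℝ) ^ (2 * q.2 + 2))⁻¹)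
      = -(x ^ 2 * y ^ 2) * ∑ q ∈ Finset.HasAntidiagonal.antidiagonal l, (-1) ^ q.2 * x ^ (2 * q.1) * y ^ (2 * q.2)
          * ((∑' n : ℕ+, ((n : ℝ) ^ (2 * q.1 + 2))⁻¹)
            * ∑' n : ℕ+, ((n : ℝ) ^ (2 * q.2 + 2))⁻¹) := by
    rw [Finset.mul_sum]
    exact Finset.sum_congr rfl fun q _ => by ring
  push_cast at hsum ⊢
  rw [hsum, ← hrec]
  field_simp
  ring
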